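/- Let $F=\langle a,b,c,d\mid a^2,b^2,c^2,d^2,bcd\rangle$, so that $\{1,b,c,d\}\cong C_2\times C_2$ and $\{1,a\}\cong C_2$ are subgroups of $F$. Denote by $0,1,2$ the three non-trivial homomorphisms $\{1,b,c,d\}\to\{1,a\}$, with kernels $\langle b\rangle,\langle c\rangle,\langle d\rangle$ respectively. For a sequence $\omega=\omega_0\omega_1\omega_2\dots\in\{0,1,2\}^{\mathbb N}$ with shift $\sigma\omega=\omega_1\omega_2\dots$, let $\tilde\phi_\omega\colon F\to F\wr\mathrm{Sym}(\{\mathbf 0,\mathbf 1\})$ be the homomorphism with $$\tilde\phi_\omega(a)=\langle\!\langle 1,1\rangle\!\rangle(\mathbf 0,\mathbf 1),\qquad \tilde\phi_\omega(x)=\langle\!\langle \omega_0(x),x\rangle\!\rangle\quad\text{for }x\in\{b,c,d\}.$$ Put $N_{\omega,0}=1$ and $N_{\omega,i+1}=\tilde\phi_\omega^{-1}(N_{\sigma\omega,i}\times N_{\sigma\omega,i})$, and let $G_\omega=F/\bigcup_{i\ge0}N_{\omega,i}$. This group acts on the right on the set $\{\mathbf 0,\mathbf 1\}^\infty$ of rays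 $\dots x_3x_2x_1$ of the binary rooted tree: if $\tilde\phi_\omega(g)=\langle\!\langle g_{\mathbf 0},g_{\mathbf 1}\rangle\!\rangle\pi$, then $(\xi'x)g=(\xi' g_x)\,x^\pi$ for every ray $\xi'$ and every letter $x$, where $g_x$ acts on $\xi'$ as an element of $G_{\sigma\omega}$. For a group $H$ and a group $G$ acting on the right on a set $X$, let $H\wr_X G=\big(\prod'_X H\big)\rtimes G$ be the restricted permutational wreath product, where $\prod'_X H$ is the group of finitely supported functions $f\colon X\to H$ and $G$ acts on it by $({}^g f)(x)=f(xg)$. A group has subexponential growth if it is generated by a finite symmetric set $S$ such that $\lim_{R\to\infty}v_S(R)^{1/R}=1$, where $v_S(R)$ is the number of elements that are products of at most $R$ elements of $S$; this does not depend on the choice of $S$. **Theorem.** Let $\omega\in\{0,1,2\}^{\mathbb N}$ contain infinitely many of each of the symbols $0,1,2$, let $\xi\in\{\mathbf 0,\mathbf 1\}^\infty$ be any ray, and let $X=\xi G_\omega$ be its orbit. If $H$ is a group of subexponential growth, then the group $W_\omega(H)=H\wr_X G_\omega$ has subexponential growth. -/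

import Mathlib

open Filter Topology

/-! ### Word growth of groups -/

section Growth

variable {G : Type*} [Group G]

/-- The word norm `‖g‖ = min {n : g = s₁ ⋯ sₙ, sᵢ ∈ S}`
(used only when `S` is a symmetric generating set, so that the minimum exists). -/
noncomputable def wordNorm (S : Set G) (g : G) : ℕ :=
  sInf {n | ∃ l : List G, l.length = n ∧ (∀ s ∈ l, s ∈ S) ∧ l.prod = g}

/-- The growth function `v(R) = #{g : ‖g‖ ≤ R}`. -/
noncomputable def growthFunction (S : Set G) (R : ℕ) : ℕ :=
  {g : G | wordNorm S g ≤ R}.ncard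

/-- `S` is a finite symmetric generating set of `G`. -/
structure IsFiniteSymmGen (S : Set G) : Prop where
  finite : S.Finite
  symm : ∀ s ∈ S, s⁻¹ ∈ S
  generates : Subgroup.closure S = ⊤

/-- The exponential growth rate `lim v(R)^(1/R)` with respect to `S` is `1`. -/
def HasUnitGrowthRate (S : Set G) : Prop :=
  Tendsto (fun R : ℕ => (growthFunction S R : ℝ) ^ ((1 : ℝ) / R)) atTop (𝓝 1)

/-- A (finitely generated) group has subexponential growth if its growth rate is `1`.
This does not depend on the generating set, see `HasSubexponentialGrowth.forall_gen`. -/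
def HasSubexponentialGrowth (G : Type*) [Group G] : Prop :=
  ∃ S : Set G, IsFiniteSymmGen S ∧ HasUnitGrowthRate S

theorem IsFiniteSymmGen.exists_word {S : Set G} (hS : IsFiniteSymmGen S) (g : G) :
    ∃ l : List G, l.length = wordNorm S g ∧ (∀ s ∈ l, s ∈ S) ∧ l.prod = g := by
  have hne : {n | ∃ l : List G, l.length = n ∧ (∀ s ∈ l, s ∈ S) ∧ l.prod = g}.Nonempty := by
    have hg : g ∈ (Subgroup.closure S).toSubmonoid := by rw [hS.generates]; trivial
    rw [Subgroup.closure_toSubmonoid] at hg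
    obtain ⟨l, hl, hp⟩ := Submonoid.exists_list_of_mem_closure hg
    refine ⟨_, l, rfl, fun s hs => ?_, hp⟩
    rcases hl s hs with h | h
    · exact h
    · simpa using hS.symm _ (Set.mem_inv.1 h)
  exact Nat.sInf_mem hne

theorem wordNorm_prod_le {S : Set G} (l : List G) (hl : ∀ s ∈ l, s ∈ S) :
    wordNorm S l.prod ≤ l.length :=
  Nat.sInf_le ⟨l, rfl, hl, rfl⟩

theorem IsFiniteSymmGen.finite_ball {S : Set G} (hS : IsFiniteSymmGen S) (R : ℕ) :
    {g : G | wordNorm S g ≤ R}.Finite := by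
  have : Finite S := hS.finite
  have hfin : {l : List S | l.length ≤ R}.Finite := List.finite_length_le S R
  refine (hfin.image (fun l => (l.map Subtype.val).prod)).subset ?_
  intro g hg
  obtain ⟨l, hlen, hmem, hp⟩ := hS.exists_word g
  refine ⟨l.attach.map (fun s => ⟨s.1, hmem s.1 s.2⟩), ?_, ?_⟩
  · simpa [hlen] using hg
  · simp [List.map_map, Function.comp_def, hp]

theorem IsFiniteSymmGen.exists_norm_bound {S T : Set G} (hS : IsFiniteSymmGen S)
    (hT : T.Finite) :
    ∃ C : ℕ, 0 < C ∧ ∀ l : List G, (∀ t ∈ l, t ∈ T) → wordNorm S l.prod ≤ C * l.length := by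
  obtain ⟨C, hC⟩ := (hT.image (wordNorm S)).bddAbove
  refine ⟨C + 1, Nat.succ_pos _, fun l hl => ?_⟩
  suffices h : ∃ m : List G, m.length ≤ (C + 1) * l.length ∧ (∀ s ∈ m, s ∈ S) ∧
      m.prod = l.prod by
    obtain ⟨m, h1, h2, h3⟩ := h
    rw [← h3]
    exact (wordNorm_prod_le m h2).trans h1
  induction l with
  | nil => exact ⟨[], by simp⟩
  | cons t l ih =>
    obtain ⟨m, h1, h2, h3⟩ := ih fun s hs => hl s (List.mem_cons_of_mem _ hs)
    obtain ⟨k, k1, k2, k3⟩ := hS.exists_word t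
    have hk : k.length ≤ C := k1 ▸ hC ⟨t, hl t List.mem_cons_self, rfl⟩
    refine ⟨k ++ m, ?_, ?_, ?_⟩
    · simp only [List.length_append, List.length_cons]
      nlinarith
    · intro s hs
      rcases List.mem_append.1 hs with h | h
      exacts [k2 s h, h2 s h]
    · simp [h3, k3]

/-- Subexponential growth does not depend on the finite generating set. -/
theorem HasSubexponentialGrowth.forall_gen (h : HasSubexponentialGrowth G) {T : Set G}
    (hT : IsFiniteSymmGen T) : HasUnitGrowthRate T := by
  obtain ⟨S, hS, hlim⟩ := h
  obtain ⟨C, hC0, hC⟩ := hS.exists_norm_bound hT.finite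
  have hle : ∀ R, growthFunction T R ≤ growthFunction S (C * R) := fun R => by
    refine Set.ncard_le_ncard ?_ (hS.finite_ball _)
    intro g hg
    obtain ⟨l, l1, l2, l3⟩ := hT.exists_word g
    have := hC l l2
    rw [l3, l1] at this
    exact this.trans (Nat.mul_le_mul_left _ hg)
  have hpos : ∀ R, 1 ≤ growthFunction T R := fun R => by
    refine (Set.ncard_pos (hT.finite_ball R)).2 ⟨1, ?_⟩
    have := wordNorm_prod_le (S := T) [] (by simp)
    simp only [List.prod_nil, List.length_nil] at this
    exact this.trans (Nat.zero_le _)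
  have hsub : Tendsto (fun R : ℕ => C * R) atTop atTop :=
    tendsto_id.const_mul_atTop' hC0
  have hup : Tendsto (fun R : ℕ =>
      ((growthFunction S (C * R) : ℝ) ^ ((1 : ℝ) / (C * R : ℕ))) ^ C) atTop (𝓝 1) := by
    simpa using (hlim.comp hsub).pow C
  refine tendsto_of_tendsto_of_tendsto_of_le_of_le' tendsto_const_nhds hup ?_ ?_
  · exact Eventually.of_forall fun R =>
      Real.one_le_rpow (by exact_mod_cast hpos R) (by positivity)
  · filter_upwards [eventually_gt_atTop 0] with R hR
    have hR' : (R : ℝ) ≠ 0 := by positivity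
    have hC' : (C : ℝ) ≠ 0 := by positivity
    rw [← Real.rpow_natCast, ← Real.rpow_mul (by positivity)]
    have e : (1 : ℝ) / (C * R : ℕ) * C = 1 / R := by push_cast; field_simp
    rw [e]
    exact Real.rpow_le_rpow (by positivity) (by exact_mod_cast hle R) (by positivity)

end Growth

/-! ### Permutational wreath products

A right action of `G` on `X` is, as usual in Mathlib, an action of `Gᵐᵒᵖ`:
`x g` is `MulOpposite.op g • x`. -/

section Wreath

/-- The restricted product `∏' H` over `X`: finitely supported functions `X → H`. -/
def restrictedPower (X H : Type*) [Group H] : Subgroup (X → H) where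
  carrier := {f | {x | f x ≠ 1}.Finite}
  one_mem' := by simp
  mul_mem' {f f'} hf hf' := (Set.Finite.union hf hf').subset fun x hx => by
    by_contra h
    simp only [Set.mem_union, Set.mem_ofPred_eq, not_or, not_not] at h
    exact hx (by simp [h.1, h.2])
  inv_mem' {f} hf := by simpa using hf

variable (H X G : Type*) [Group H] [Group G] [MulAction Gᵐᵒᵖ X]

theorem translate_mem (g : G) (f : restrictedPower X H) :
    (fun x => f.1 (MulOpposite.op g • x)) ∈ restrictedPower X H :=
  Set.Finite.preimage (MulAction.injective (MulOpposite.op g)).injOn f.2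

/-- The left action of `G` on the base group, `(ᵍf)(x) = f(x g)`. -/
def translateHom : G →* MulAut (restrictedPower X H) where
  toFun g :=
    { toFun := fun f => ⟨fun x => f.1 (MulOpposite.op g • x), translate_mem H X G g f⟩
      invFun := fun f => ⟨fun x => f.1 (MulOpposite.op g⁻¹ • x), translate_mem H X G g⁻¹ f⟩
      left_inv := fun f => by ext x; simp
      right_inv := fun f => by ext x; simp
      map_mul' := fun f f' => by ext x; simp }
  map_one' := by ext f x; simp
  map_mul' g g' := by ext f x; simp [mul_smul]

/-- The restricted permutational wreath product `H ≀_X G = (∏' H) ⋊ G`, with product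
`(f g)(f' g') = (f · ᵍf')(g g')`. -/
abbrev PermWreath : Type _ := restrictedPower X H ⋊[translateHom H X G] G

end Wreath

/-- The symmetric group of `X` acting on the right: `σ τ` means first `σ`, then `τ`. -/
abbrev RightSym (X : Type*) : Type _ := (Equiv.Perm X)ᵐᵒᵖ

instance RightSym.instMulAction (X : Type*) : MulAction (RightSym X)ᵐᵒᵖ X where
  smul π x := π.unop.unop x
  one_smul _ := rfl
  mul_smul _ _ _ := rfl

/-! ### The Grigorchuk family

The alphabet `{𝟎, 𝟏}` is `Bool`, with `𝟎 = false` and `𝟏 = true`. -/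

section Grigorchuk

inductive GrigLetter : Type
  | a | b | c | d

open GrigLetter

/-- The relators `a², b², c², d², bcd`. -/
def grigRels : Set (FreeGroup GrigLetter) :=
  {FreeGroup.of a ^ 2, FreeGroup.of b ^ 2, FreeGroup.of c ^ 2, FreeGroup.of d ^ 2,
    FreeGroup.of b * FreeGroup.of c * FreeGroup.of d}

/-- `F = ⟨a, b, c, d ∣ a², b², c², d², bcd⟩`. -/
abbrev GrigF : Type := PresentedGroup grigRels

/-- The generators of `F`. -/
def grigGen (s : GrigLetter) : GrigF := PresentedGroup.of s

/-- The three non-trivial homomorphisms `{1, b, c, d} → {1, a}` evaluated at `b, c, d`: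
the kernels of `0`, `1`, `2` are `⟨b⟩`, `⟨c⟩`, `⟨d⟩`. (The value at `a` is irrelevant.) -/
def grigHom (i : Fin 3) : GrigLetter → GrigF
  | a => 1
  | b => if i = 0 then 1 else grigGen a
  | c => if i = 1 then 1 else grigGen a
  | d => if i = 2 then 1 else grigGen a

/-- The decorated permutation `⟨⟨g₀, g₁⟩⟩ π` of `{𝟎, 𝟏}`. -/
def decorated (g₀ g₁ : GrigF) (π : Equiv.Perm Bool) : PermWreath GrigF Bool (RightSym Bool) :=
  ⟨⟨fun x => bif x then g₁ else g₀, Set.toFinite _⟩, MulOpposite.op π⟩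

/-- The wreath recursion on generators: `a ↦ ⟨⟨1, 1⟩⟩ (𝟎 𝟏)`, and
`x ↦ ⟨⟨i(x), x⟩⟩` for `x = b, c, d`. -/
def grigRecGen (i : Fin 3) : GrigLetter → PermWreath GrigF Bool (RightSym Bool)
  | a => decorated 1 1 (Equiv.swap false true)
  | b => decorated (grigHom i b) (grigGen b) 1
  | c => decorated (grigHom i c) (grigGen c) 1
  | d => decorated (grigHom i d) (grigGen d) 1

theorem decorated_mul_one (g₀ g₁ h₀ h₁ : GrigF) (π : Equiv.Perm Bool) :
    decorated g₀ g₁ 1 * decorated h₀ h₁ π = decorated (g₀ * h₀) (g₁ * h₁) π := by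
  ext x
  · cases x <;> rfl
  · simp [decorated]

theorem decorated_one : decorated 1 1 1 = 1 := by
  ext x
  · cases x <;> rfl
  · rfl

theorem grigGen_sq (s : GrigLetter) : grigGen s * grigGen s = 1 := by
  have h : FreeGroup.of s ^ 2 ∈ grigRels := by cases s <;> simp [grigRels]
  have := PresentedGroup.one_of_mem h
  rw [pow_two] at this
  simpa [grigGen, PresentedGroup.of] using this

theorem grigGen_bcd : grigGen b * grigGen c * grigGen d = 1 := by
  have h : FreeGroup.of b * FreeGroup.of c * FreeGroup.of d ∈ grigRels := by simp [grigRels]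
  simpa [grigGen, PresentedGroup.of] using PresentedGroup.one_of_mem h

theorem grigHom_sq (i : Fin 3) (s : GrigLetter) : grigHom i s * grigHom i s = 1 := by
  cases s <;> simp only [grigHom] <;> (try split_ifs) <;> simp [grigGen_sq]

theorem grigHom_bcd (i : Fin 3) : grigHom i b * grigHom i c * grigHom i d = 1 := by
  fin_cases i <;> simp [grigHom, grigGen_sq]

theorem grigRecGen_rels (i : Fin 3) :
    ∀ r ∈ grigRels, FreeGroup.lift (grigRecGen i) r = 1 := by
  rintro r (rfl | rfl | rfl | rfl | rfl)
  · simp only [map_mul, FreeGroup.lift_apply_of, grigRecGen, pow_two]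
    ext x
    · cases x <;> exact mul_one (1 : GrigF)
    · simp [decorated, ← MulOpposite.op_mul]
  all_goals
    simp only [map_mul, FreeGroup.lift_apply_of, grigRecGen, pow_two, decorated_mul_one,
      grigHom_sq, grigGen_sq, grigHom_bcd, grigGen_bcd, decorated_one]

/-- The homomorphism `F → F ≀ Sym({𝟎, 𝟏})` attached to a letter `i = ω₀`. -/
def grigRec (i : Fin 3) : GrigF →* PermWreath GrigF Bool (RightSym Bool) :=
  PresentedGroup.toGroup (grigRecGen_rels i)

/-- The label `g_x` of the wreath recursion of `g`. -/
def grigLabel (i : Fin 3) (g : GrigF) (x : Bool) : GrigF := (grigRec i g).left.1 x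

/-- The permutation part of the wreath recursion of `g`, acting on the right: `x ↦ x^π`. -/
def grigPerm (i : Fin 3) (g : GrigF) (x : Bool) : Bool := (grigRec i g).right.unop x

theorem grigLabel_one (i : Fin 3) (x : Bool) : grigLabel i 1 x = 1 := by simp [grigLabel]

theorem grigPerm_one (i : Fin 3) (x : Bool) : grigPerm i 1 x = x := by simp [grigPerm]

theorem grigLabel_mul (i : Fin 3) (g h : GrigF) (x : Bool) :
    grigLabel i (g * h) x = grigLabel i g x * grigLabel i h (grigPerm i g x) := by
  simp only [grigLabel, map_mul]
  rfl

theorem grigPerm_mul (i : Fin 3) (g h : GrigF) (x : Bool) :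
    grigPerm i (g * h) x = grigPerm i h (grigPerm i g x) := by
  simp [grigPerm]

/-- The shift `σ(ω₀ω₁ω₂…) = ω₁ω₂…`. -/
def seqShift {A : Type*} (ω : ℕ → A) : ℕ → A := fun n => ω (n + 1)

/-- The subgroups `N_{ω,0} = 1`, `N_{ω,n+1} = φ_ω⁻¹(N_{σω,n} × N_{σω,n})` of `F`. -/
def grigN : (ℕ → Fin 3) → ℕ → Subgroup GrigF
  | _, 0 => ⊥
  | ω, n + 1 =>
    { carrier := {g | (∀ x, grigPerm (ω 0) g x = x) ∧
        ∀ x, grigLabel (ω 0) g x ∈ grigN (seqShift ω) n}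
      one_mem' := ⟨grigPerm_one _, fun x => by rw [grigLabel_one]; exact one_mem _⟩
      mul_mem' := fun {g h} hg hh =>
        ⟨fun x => by rw [grigPerm_mul, hg.1, hh.1],
          fun x => by rw [grigLabel_mul, hg.1]; exact mul_mem (hg.2 x) (hh.2 x)⟩
      inv_mem' := fun {g} hg => by
        have hp : ∀ x, grigPerm (ω 0) g⁻¹ x = x := fun x => by
          have := grigPerm_mul (ω 0) g g⁻¹ x
          rwa [mul_inv_cancel, grigPerm_one, hg.1, eq_comm] at this
        refine ⟨hp, fun x => ?_⟩
        have := grigLabel_mul (ω 0) g g⁻¹ x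
        rw [mul_inv_cancel, grigLabel_one, hg.1] at this
        rw [← inv_eq_of_mul_eq_one_right this.symm]
        exact inv_mem (hg.2 x) }

theorem grigN_normal (ω : ℕ → Fin 3) (n : ℕ) : (grigN ω n).Normal := by
  induction n generalizing ω with
  | zero => exact inferInstanceAs (⊥ : Subgroup GrigF).Normal
  | succ n ih =>
    refine ⟨fun g hg k => ?_⟩
    have hk : ∀ x, grigPerm (ω 0) k⁻¹ (grigPerm (ω 0) k x) = x := fun x => by
      rw [← grigPerm_mul, mul_inv_cancel, grigPerm_one]
    have hl : ∀ x, grigLabel (ω 0) k⁻¹ (grigPerm (ω 0) k x) = (grigLabel (ω 0) k x)⁻¹ :=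
      fun x => by
        have := grigLabel_mul (ω 0) k k⁻¹ x
        rw [mul_inv_cancel, grigLabel_one] at this
        exact (inv_eq_of_mul_eq_one_right this.symm).symm
    refine ⟨fun x => ?_, fun x => ?_⟩
    · rw [grigPerm_mul, grigPerm_mul, hg.1, hk]
    · rw [grigLabel_mul, grigPerm_mul, grigLabel_mul, hg.1, hl]
      exact (ih (seqShift ω)).conj_mem _ (hg.2 _) _

theorem grigN_le_succ (ω : ℕ → Fin 3) (n : ℕ) : grigN ω n ≤ grigN ω (n + 1) := by
  induction n generalizing ω with
  | zero => exact bot_le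
  | succ n ih => exact fun g hg => ⟨hg.1, fun x => ih (seqShift ω) (hg.2 x)⟩

theorem grigN_mono (ω : ℕ → Fin 3) : Monotone (grigN ω) :=
  monotone_nat_of_le_succ (grigN_le_succ ω)

/-- The increasing union of the subgroups `N_{ω,n}`. -/
def grigKer (ω : ℕ → Fin 3) : Subgroup GrigF := ⨆ n, grigN ω n

theorem mem_grigKer (ω : ℕ → Fin 3) (g : GrigF) : g ∈ grigKer ω ↔ ∃ n, g ∈ grigN ω n :=
  Subgroup.mem_iSup_of_directed (grigN_mono ω).directed_le

instance grigKer_normal (ω : ℕ → Fin 3) : (grigKer ω).Normal :=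
  ⟨fun g hg k => by
    obtain ⟨n, hn⟩ := (mem_grigKer ω g).1 hg
    exact (mem_grigKer ω _).2 ⟨n, (grigN_normal ω n).conj_mem g hn k⟩⟩

/-- The group `G_ω`, the quotient of `F` by the union of the `N_{ω,n}`. -/
abbrev GrigGroup (ω : ℕ → Fin 3) : Type := GrigF ⧸ grigKer ω

/-- Rays `… x₃ x₂ x₁ ∈ {𝟎, 𝟏}^∞` of the binary rooted tree; `x₁`, the letter next to
the root, is the value at `0`. -/
abbrev Ray : Type := ℕ → Bool

/-- The right action of `F` on rays, `(ξ' x) g = (ξ' g_x) x^π`, where the label `g_x` acts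
on `ξ'` through the shifted sequence; letter by letter. -/
def rayAct : ℕ → (ℕ → Fin 3) → GrigF → Ray → Bool
  | 0, ω, g, ξ => grigPerm (ω 0) g (ξ 0)
  | n + 1, ω, g, ξ => rayAct n (seqShift ω) (grigLabel (ω 0) g (ξ 0)) (seqShift ξ)

theorem rayAct_one (n : ℕ) (ω : ℕ → Fin 3) (ξ : Ray) : rayAct n ω 1 ξ = ξ n := by
  induction n generalizing ω ξ with
  | zero => exact grigPerm_one _ _
  | succ n ih => rw [rayAct, grigLabel_one, ih]; rfl

theorem rayAct_mul (n : ℕ) (ω : ℕ → Fin 3) (g h : GrigF) (ξ : Ray) :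
    rayAct n ω (g * h) ξ = rayAct n ω h (fun m => rayAct m ω g ξ) := by
  induction n generalizing ω g h ξ with
  | zero => exact grigPerm_mul _ _ _ _
  | succ n ih => rw [rayAct, grigLabel_mul, ih]; rfl

theorem rayAct_of_mem (n : ℕ) (ω : ℕ → Fin 3) (g : GrigF) (hg : g ∈ grigKer ω) (ξ : Ray) :
    rayAct n ω g ξ = ξ n := by
  obtain ⟨k, hk⟩ := (mem_grigKer ω g).1 hg
  clear hg
  induction k generalizing n ω g ξ with
  | zero =>
    have : g = 1 := Subgroup.mem_bot.1 hk
    rw [this, rayAct_one]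
  | succ k ih =>
    cases n with
    | zero => exact hk.1 _
    | succ n => rw [rayAct, ih n (seqShift ω) _ _ (hk.2 _)]; rfl

/-- The right action of `G_ω` on rays. -/
instance rayMulAction (ω : ℕ → Fin 3) : MulAction (GrigGroup ω)ᵐᵒᵖ Ray where
  smul g ξ := Quotient.liftOn' (MulOpposite.unop g) (fun k n => rayAct n ω k ξ) (by
    intro g h hgh
    have hm := QuotientGroup.leftRel_apply.1 hgh
    funext n
    have e : h = g * (g⁻¹ * h) := by group
    rw [e, rayAct_mul, rayAct_of_mem n ω _ hm])
  one_smul ξ := funext fun n => rayAct_one n ω ξ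
  mul_smul g h ξ := by
    induction g using MulOpposite.rec' with | _ g
    induction h using MulOpposite.rec' with | _ h
    induction g using QuotientGroup.induction_on with | _ g
    induction h using QuotientGroup.induction_on with | _ h
    exact funext fun n => rayAct_mul n ω h g ξ

/-- `Ω'`: sequences containing infinitely many of each of the symbols `0, 1, 2`. -/
def OmegaPrime : Set (ℕ → Fin 3) := {ω | ∀ i : Fin 3, {n | ω n = i}.Infinite}

/-- The orbit `X = ξ G_ω`. -/
abbrev rayOrbit (ω : ℕ → Fin 3) (ξ : Ray) : Set Ray := MulAction.orbit (GrigGroup ω)ᵐᵒᵖ ξ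

/-- `W_ω(H) = H ≀_X G_ω`, where `X = ξ G_ω`. -/
abbrev GrigWreath (H : Type*) [Group H] (ω : ℕ → Fin 3) (ξ : Ray) : Type _ :=
  PermWreath H (rayOrbit ω ξ) (GrigGroup ω)

end Grigorchuk

/-! An element of norm at most `R` in the wreath product is read off a word in `a, b, c, d` along
which elements of `H` are deposited. It consists of an element of `G_ω` and a function of total norm
at most `R`, supported on points that a prefix of the word carries to `ξ`. It suffices that such
words give subexponentially many elements of `G_ω`, and that the supports lie in sets of `o(R)`
points, themselves taken from a subexponential list. Both follow from one contraction.

Let `a` weigh 1 and let each `v` in `{1, b, c, d}` weigh 1 or 2. Under the wreath recursion, `v`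
leaves a `v` in one label and an `a` in the other, unless `ω 0` kills it. In that case the `a` is
lost, and the unit saved pays for raising the weight of `v` from 1 to 2
(`weightedLength_labelWord`). Since all three symbols occur in `ω`, after finitely many levels all
weights are 2, while the total has grown only by a constant. A word with `n` letters `a` weighs `2 +
3n` instead of `1 + 2n`, so the total length of the labels is at most 2/3 of the original, up to a
constant. Repeating this `m` times gives the factor `(2/3)^m` (`hasCoding_pow`).

The labels at the leaves and the permutations above them form a code. It determines the element of
`G_ω`, and it also bounds the support, because hitting sets pass to hitting sets of labels
(`seqShift_mem_hits`).

For `t < 1` the sum `Z` of `t ^ ‖h‖` over `H` is finite, so a code of weight `n` leaves at most `Z ^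
(8n) * t ^ (-R)` functions. With `t` close to 1 and then `m` large, the count is below `K * q ^ R`
for any given `q > 1`. -/

/-! ### The Klein four-group `{1, b, c, d}` -/

/-- The four-group `{1, b, c, d}`; the coordinates are the exponents of `b` and `c`. -/
abbrev Klein : Type := Bool × Bool

namespace Klein

/-- Multiplication in `{1, b, c, d}`. -/
def mul (u v : Klein) : Klein := (xor u.1 v.1, xor u.2 v.2)

/-- The identity of `{1, b, c, d}`. -/
def one : Klein := (false, false)

/-- The inclusion of `{1, b, c, d}` into `F`. -/
def toF (v : Klein) : GrigF :=
  (if v.1 then grigGen .b else 1) * (if v.2 then grigGen .c else 1)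

/-- Whether the homomorphism `i : {1, b, c, d} → {1, a}` kills `v`. -/
def killed (i : Fin 3) (v : Klein) : Bool :=
  if i = 0 then !v.2 else if i = 1 then !v.1 else v.1 == v.2

@[simp] protected theorem mul_one (v : Klein) : mul v one = v := by revert v; decide

@[simp] protected theorem one_mul (v : Klein) : mul one v = v := by revert v; decide

theorem exists_killed (v : Klein) : ∃ i, killed i v = true := by revert v; decide

end Klein

open Klein

theorem grigGen_inv (s : GrigLetter) : (grigGen s)⁻¹ = grigGen s :=
  inv_eq_of_mul_eq_one_right (grigGen_sq s)

theorem grigGen_bc : grigGen .b * grigGen .c = grigGen .d := by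
  rw [← grigGen_inv .d]
  exact eq_inv_of_mul_eq_one_left grigGen_bcd

theorem grigGen_cb : grigGen .c * grigGen .b = grigGen .d := by
  have := congrArg (·⁻¹) grigGen_bc
  simpa [grigGen_inv] using this

theorem Klein.toF_mul (u v : Klein) : toF (mul u v) = toF u * toF v := by
  have hbb := grigGen_sq .b
  have hcc := grigGen_sq .c
  have hcb : grigGen .c * grigGen .b = grigGen .b * grigGen .c := by
    rw [grigGen_bc, grigGen_cb]
  have hbb' : ∀ x, grigGen .b * (grigGen .b * x) = x := fun x => by
    rw [← mul_assoc, hbb, one_mul]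
  have hcb' : ∀ x, grigGen .c * (grigGen .b * x) = grigGen .b * (grigGen .c * x) := fun x => by
    rw [← mul_assoc, hcb, mul_assoc]
  rcases u with ⟨_ | _, _ | _⟩ <;> rcases v with ⟨_ | _, _ | _⟩ <;>
    simp [toF, mul, hbb, hcc, hcb, hbb', hcb', mul_assoc]

@[simp] theorem Klein.toF_one : toF one = 1 := by simp [toF, one]

theorem Klein.toF_mul_self (v : Klein) : toF v * toF v = 1 := by
  have : mul v v = one := by revert v; decide
  rw [← toF_mul, this, toF_one]

/-! ### The wreath recursion on generators -/

theorem grigRec_gen (i : Fin 3) (s : GrigLetter) : grigRec i (grigGen s) = grigRecGen i s :=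
  PresentedGroup.toGroup.of _

@[simp] theorem grigPerm_gen_a (i : Fin 3) (x : Bool) : grigPerm i (grigGen .a) x = !x := by
  rw [grigPerm, grigRec_gen]
  cases x <;> simp [grigRecGen, decorated]

@[simp] theorem grigLabel_gen_a (i : Fin 3) (x : Bool) : grigLabel i (grigGen .a) x = 1 := by
  rw [grigLabel, grigRec_gen]
  cases x <;> simp [grigRecGen, decorated]

@[simp] theorem grigPerm_toF (i : Fin 3) (v : Klein) (x : Bool) : grigPerm i (toF v) x = x := by
  have hb : ∀ x, grigPerm i (grigGen .b) x = x := fun x => by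
    simp [grigPerm, grigRec_gen, grigRecGen, decorated]
  have hc : ∀ x, grigPerm i (grigGen .c) x = x := fun x => by
    simp [grigPerm, grigRec_gen, grigRecGen, decorated]
  rcases v with ⟨_ | _, _ | _⟩ <;> simp [toF, grigPerm_mul, grigPerm_one, hb, hc]

@[simp] theorem grigLabel_toF_true (i : Fin 3) (v : Klein) :
    grigLabel i (toF v) true = toF v := by
  have hp : grigPerm i (grigGen .b) true = true := by
    simp [grigPerm, grigRec_gen, grigRecGen, decorated]
  have hb : grigLabel i (grigGen .b) true = grigGen .b := by
    simp [grigLabel, grigRec_gen, grigRecGen, decorated]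
  have hc : grigLabel i (grigGen .c) true = grigGen .c := by
    simp [grigLabel, grigRec_gen, grigRecGen, decorated]
  rcases v with ⟨_ | _, _ | _⟩ <;> simp [toF, grigLabel_mul, grigLabel_one, hp, hb, hc]

@[simp] theorem grigLabel_toF_false (i : Fin 3) (v : Klein) :
    grigLabel i (toF v) false = if killed i v then 1 else grigGen .a := by
  have hp : grigPerm i (grigGen .b) false = false := by
    simp [grigPerm, grigRec_gen, grigRecGen, decorated]
  have hb : grigLabel i (grigGen .b) false = if i = 0 then 1 else grigGen .a := by
    simp [grigLabel, grigRec_gen, grigRecGen, decorated, grigHom]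
  have hc : grigLabel i (grigGen .c) false = if i = 1 then 1 else grigGen .a := by
    simp [grigLabel, grigRec_gen, grigRecGen, decorated, grigHom]
  fin_cases i <;> rcases v with ⟨_ | _, _ | _⟩ <;>
    simp_all [toF, grigLabel_mul, grigLabel_one, killed, grigGen_sq]

/-! ### The action of `F` on rays -/

/-- The right action of `F` on rays. -/
def grigAct (ω : ℕ → Fin 3) (g : GrigF) (x : Ray) : Ray := fun n => rayAct n ω g x

@[simp] theorem grigAct_one (ω : ℕ → Fin 3) (x : Ray) : grigAct ω 1 x = x :=
  funext fun n => rayAct_one n ω x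

theorem grigAct_mul (ω : ℕ → Fin 3) (g h : GrigF) (x : Ray) :
    grigAct ω (g * h) x = grigAct ω h (grigAct ω g x) :=
  funext fun n => rayAct_mul n ω g h x

theorem grigAct_zero (ω : ℕ → Fin 3) (g : GrigF) (x : Ray) :
    grigAct ω g x 0 = grigPerm (ω 0) g (x 0) := rfl

theorem seqShift_grigAct (ω : ℕ → Fin 3) (g : GrigF) (x : Ray) :
    seqShift (grigAct ω g x) = grigAct (seqShift ω) (grigLabel (ω 0) g (x 0)) (seqShift x) := rfl

/-! ### Words `h a t₁ a t₂ … a tₙ` and their labels -/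

/-- The element `h a t₁ a t₂ … a tₙ` of `F`. -/
def wordValue : Klein → List Klein → GrigF
  | h, [] => toF h
  | h, k :: t => toF h * grigGen .a * wordValue k t

theorem wordValue_mul (u h : Klein) (t : List Klein) :
    wordValue (mul u h) t = toF u * wordValue h t := by
  cases t <;> simp [wordValue, toF_mul, mul_assoc]

/-- Words for the two labels of `h a t₁ … a tₙ`. -/
def labelWords (i : Fin 3) : Klein → List Klein → (Klein × List Klein) × (Klein × List Klein)
  | h, [] => ((one, if killed i h then [] else [one]), (h, []))
  | h, k :: t =>
    let r := labelWords i k t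
    (if killed i h then r.2 else (one, r.2.1 :: r.2.2), (mul h r.1.1, r.1.2))

/-- The word for the label at `x`. -/
def labelWord (i : Fin 3) (w : Klein × List Klein) (x : Bool) : Klein × List Klein :=
  bif x then (labelWords i w.1 w.2).2 else (labelWords i w.1 w.2).1

/-- The block `h a` contributes `h` to the label at `true` and `1` or `a` to the label at `false`,
and its `a` exchanges the two labels of the remaining word. -/
theorem wordValue_labelWords (i : Fin 3) (h : Klein) (t : List Klein) :
    wordValue (labelWords i h t).1.1 (labelWords i h t).1.2 = grigLabel i (wordValue h t) false ∧
    wordValue (labelWords i h t).2.1 (labelWords i h t).2.2 = grigLabel i (wordValue h t) true := by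
  induction t generalizing h with
  | nil => by_cases hk : killed i h <;> simp [labelWords, wordValue, hk]
  | cons k t ih =>
    by_cases hk : killed i h <;>
      simp [labelWords, wordValue, hk, ih, wordValue_mul, grigLabel_mul, grigPerm_mul]

theorem wordValue_labelWord (i : Fin 3) (w : Klein × List Klein) (x : Bool) :
    wordValue (labelWord i w x).1 (labelWord i w x).2 = grigLabel i (wordValue w.1 w.2) x := by
  cases x
  exacts [(wordValue_labelWords i w.1 w.2).1, (wordValue_labelWords i w.1 w.2).2]

/-- The length of a word, where `a` has weight `1` and `v ∈ {1, b, c, d}` has weight `c v`. -/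
def weightedLength (c : Klein → ℕ) (w : Klein × List Klein) : ℕ :=
  c w.1 + (w.2.map fun v => 1 + c v).sum

/-- An amortized count. A block `h a` weighs `c h + 1`. If `h` is not killed it yields `h`, still of
weight `c h`, and one `a`; if killed, it yields only `h`, of weight at most `2 ≤ c h + 1`. A head
`1` of the `false` label is not charged, since the next `h` to the left is merged into it. Merging
into a non-trivial head costs at most `2 - 1 ≤ c h`. -/
theorem weightedLength_labelWords_aux (i : Fin 3) {c c' : Klein → ℕ}
    (hc : ∀ v, 1 ≤ c v) (hc' : ∀ v, 1 ≤ c' v ∧ c' v ≤ 2)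
    (h0 : ∀ v, killed i v = false → c' v = c v) (h : Klein) (t : List Klein) :
    weightedLength c' (labelWords i h t).2 + (if (labelWords i h t).1.1 = one then 0 else
      c' (labelWords i h t).1.1) + ((labelWords i h t).1.2.map fun v => 1 + c' v).sum ≤
      weightedLength c (h, t) + 4 := by
  induction t generalizing h with
  | nil =>
    have := hc h
    have := hc' h
    have := hc' one
    have := h0 h
    by_cases hk : killed i h
    · simp [labelWords, weightedLength, hk]; omega
    · simp [labelWords, weightedLength, hk]; omega
  | cons k t ih =>
    specialize ih k
    have h1 := hc h
    have h2 := hc' h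
    have h3 := hc' (mul h (labelWords i k t).1.1)
    have h4 := hc' (labelWords i k t).1.1
    have h5 := hc' (labelWords i k t).2.1
    have h6 := h0 h
    simp only [weightedLength] at ih ⊢
    by_cases hk : killed i h <;> by_cases hz : (labelWords i k t).1.1 = one <;>
      by_cases hy : (labelWords i k t).2.1 = one <;>
      simp [labelWords, hk, hz, hy] at * <;> omega

theorem weightedLength_labelWord (i : Fin 3) {c c' : Klein → ℕ}
    (hc : ∀ v, 1 ≤ c v) (hc' : ∀ v, 1 ≤ c' v ∧ c' v ≤ 2)
    (h0 : ∀ v, killed i v = false → c' v = c v) (w : Klein × List Klein) :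
    weightedLength c' (labelWord i w false) + weightedLength c' (labelWord i w true) ≤
      weightedLength c w + 6 := by
  have h1 := weightedLength_labelWords_aux i hc hc' h0 w.1 w.2
  have h2 := hc' (labelWords i w.1 w.2).1.1
  simp only [weightedLength, labelWord, cond_true, cond_false] at h1 ⊢
  -- Charging the omitted head adds at most 2, whence `4 + 2 = 6`.
  split_ifs at h1 <;> omega

/-! ### Hitting sets -/

open Classical in
/-- The points `x` such that `x p ∈ Y` for some prefix `p = h a t₁ … tₖ a`. -/
noncomputable def hits (ω : ℕ → Fin 3) (Y : Finset Ray) : Klein → List Klein → Finset Ray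
  | _, [] => Y
  | h, k :: t => Y ∪ (hits ω Y k t).image (grigAct ω (toF h * grigGen .a)⁻¹)

theorem mem_hits_cons {ω : ℕ → Fin 3} {Y : Finset Ray} {h k : Klein} {t : List Klein} {x : Ray} :
    x ∈ hits ω Y h (k :: t) ↔ x ∈ Y ∨ grigAct ω (toF h * grigGen .a) x ∈ hits ω Y k t := by
  classical
  simp only [hits, Finset.mem_union, Finset.mem_image]
  refine or_congr_right ⟨?_, fun hx => ⟨_, hx, ?_⟩⟩
  · rintro ⟨y, hy, rfl⟩
    rwa [← grigAct_mul, inv_mul_cancel, grigAct_one]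
  · rw [← grigAct_mul, mul_inv_cancel, grigAct_one]

theorem subset_hits (ω : ℕ → Fin 3) (Y : Finset Ray) (h : Klein) (t : List Klein) :
    Y ⊆ hits ω Y h t := by
  cases t with
  | nil => exact subset_rfl
  | cons k t => exact fun x hx => mem_hits_cons.2 (Or.inl hx)

theorem card_hits_le (ω : ℕ → Fin 3) (Y : Finset Ray) (h : Klein) (t : List Klein) :
    (hits ω Y h t).card ≤ Y.card * (t.length + 1) := by
  classical
  induction t generalizing h with
  | nil => simp [hits]
  | cons k t ih =>
    refine (Finset.card_union_le _ _).trans ?_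
    have := (Finset.card_image_le (s := hits ω Y k t)
      (f := grigAct ω (toF h * grigGen .a)⁻¹)).trans (ih k)
    rw [List.length_cons]
    linarith

/-- Invariance of `Y` under `{1, b, c, d}` makes it harmless that `hits` tests only prefixes that
are empty or end in `a`. -/
theorem mem_hits_mul {ω : ℕ → Fin 3} {Y : Finset Ray}
    (hY : ∀ v, ∀ y ∈ Y, grigAct ω (toF v) y ∈ Y) {u h : Klein} {t : List Klein} {x : Ray}
    (hx : grigAct ω (toF u) x ∈ hits ω Y h t) : x ∈ hits ω Y (mul u h) t := by
  have key : grigAct ω (toF u) x ∈ Y → x ∈ Y := fun hy => by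
    have := hY u _ hy
    rwa [← grigAct_mul, toF_mul_self, grigAct_one] at this
  cases t with
  | nil => exact key hx
  | cons k t =>
    rw [mem_hits_cons] at hx ⊢
    refine hx.imp key fun h => ?_
    rwa [toF_mul, mul_assoc, grigAct_mul]

/-- If `x p` lies in `Y`, its shift is the shift of `x` moved by the label of `p` at `x 0`, and that
label is, up to a factor in `{1, b, c, d}`, a prefix of the label of the whole word. -/
theorem seqShift_mem_hits {ω : ℕ → Fin 3} {Y Y' : Finset Ray}
    (hY' : ∀ v, ∀ y ∈ Y', grigAct (seqShift ω) (toF v) y ∈ Y')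
    (hYY : ∀ y ∈ Y, seqShift y ∈ Y') {h : Klein} {t : List Klein} {x : Ray}
    (hx : x ∈ hits ω Y h t) :
    seqShift x ∈ hits (seqShift ω) Y' (labelWord (ω 0) (h, t) (x 0)).1
      (labelWord (ω 0) (h, t) (x 0)).2 := by
  induction t generalizing h x with
  | nil => exact subset_hits _ _ _ _ (hYY x hx)
  | cons k t ih =>
    rcases mem_hits_cons.1 hx with hx | hx
    · exact subset_hits _ _ _ _ (hYY x hx)
    · have h1 := ih hx
      rw [seqShift_grigAct, grigAct_zero, grigPerm_mul, grigPerm_toF, grigPerm_gen_a,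
        grigLabel_mul, grigLabel_gen_a, mul_one] at h1
      rcases hx0 : x 0 with _ | _
      · rw [hx0, grigLabel_toF_false] at h1
        by_cases hk : killed (ω 0) h
        · simpa [labelWord, labelWords, hk] using h1
        · simp only [labelWord, labelWords, hk, cond_false, if_false, Bool.false_eq_true,
            mem_hits_cons]
          right
          simpa [hk, labelWord] using h1
      · rw [hx0, grigLabel_toF_true] at h1
        exact mem_hits_mul hY' h1

open Classical in
/-- The points `ξ u v` with `u ∈ {1, a}` and `v ∈ {1, b, c, d}`. -/
noncomputable def basePoints (ω : ℕ → Fin 3) (ξ : Ray) : Finset Ray :=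
  Finset.univ.image fun p : Bool × Klein =>
    grigAct ω ((if p.1 then grigGen .a else 1) * toF p.2) ξ

theorem card_basePoints_le (ω : ℕ → Fin 3) (ξ : Ray) : (basePoints ω ξ).card ≤ 8 := by
  classical
  exact Finset.card_image_le.trans (by simp)

theorem self_mem_basePoints (ω : ℕ → Fin 3) (ξ : Ray) : ξ ∈ basePoints ω ξ := by
  classical
  exact Finset.mem_image.2 ⟨(false, one), by simp⟩

theorem grigAct_toF_mem_basePoints (ω : ℕ → Fin 3) (ξ : Ray) (v : Klein) (y : Ray)
    (hy : y ∈ basePoints ω ξ) : grigAct ω (toF v) y ∈ basePoints ω ξ := by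
  classical
  obtain ⟨⟨u, k⟩, -, rfl⟩ := Finset.mem_image.1 hy
  refine Finset.mem_image.2 ⟨(u, mul k v), Finset.mem_univ _, ?_⟩
  rw [← grigAct_mul, mul_assoc, ← toF_mul]

/-- As `a` has trivial labels, the shift of `ξ u v` is the shift of `ξ` moved by a label of `v`,
which is in `{1, a}` or in `{1, b, c, d}`. Hence the bound 8 on these sets does not deteriorate with
depth. -/
theorem seqShift_mem_basePoints (ω : ℕ → Fin 3) (ξ : Ray) (y : Ray) (hy : y ∈ basePoints ω ξ) :
    seqShift y ∈ basePoints (seqShift ω) (seqShift ξ) := by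
  classical
  obtain ⟨⟨u, k⟩, -, rfl⟩ := Finset.mem_image.1 hy
  have key : ∀ x, ∃ p : Bool × Klein,
      (if p.1 then grigGen .a else 1) * toF p.2 = grigLabel (ω 0) (toF k) x := by
    rintro (_ | _)
    · by_cases hk : killed (ω 0) k
      · exact ⟨(false, one), by simp [hk]⟩
      · exact ⟨(true, one), by simp [hk]⟩
    · exact ⟨(false, k), by simp⟩
  obtain ⟨p, hp⟩ := key (grigPerm (ω 0) (if u then grigGen .a else 1) (ξ 0))
  refine Finset.mem_image.2 ⟨p, Finset.mem_univ _, ?_⟩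
  rw [hp, seqShift_grigAct, grigLabel_mul]
  cases u <;> simp [grigLabel_one]

/-! ### Coding words by portraits -/

/-- The words can be coded such that the code determines the element of `G_ω`, bounds the hitting
set, and has weight at most `A` times the weighted length of the word, up to a constant; and the
number of codes is at most exponential in the weight. -/
def HasCoding (ω : ℕ → Fin 3) (ξ : Ray) (c : Klein → ℕ) (A : ℝ) : Prop :=
  ∃ (ι : Type) (wt : ι → ℕ) (O : ι → Finset Ray) (code : Klein × List Klein → ι) (B : ℝ),
    Summable (fun i => (8⁻¹ : ℝ) ^ wt i) ∧
    (∀ i, (O i).card ≤ 8 * wt i) ∧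
    (∀ w w', code w = code w' →
      (wordValue w.1 w.2 : GrigGroup ω) = (wordValue w'.1 w'.2 : GrigGroup ω)) ∧
    (∀ w, hits ω (basePoints ω ξ) w.1 w.2 ⊆ O (code w)) ∧
    ∀ w, (wt (code w) : ℝ) ≤ A * weightedLength c w + B

/-- There are `4 ^ (n + 1)` words with `n` letters `a`, so the series is geometric of ratio 1/2. -/
theorem summable_inv_eight_pow_length :
    Summable fun w : Klein × List Klein => (8⁻¹ : ℝ) ^ (w.2.length + 1) := by
  have h1 : Summable fun t : List Klein => (8⁻¹ : ℝ) ^ t.length := by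
    rw [← (List.equivSigmaTuple (α := Klein)).symm.summable_iff]
    refine (summable_sigma_of_nonneg fun _ => pow_nonneg (by norm_num) _).2 ⟨fun n => (hasSum_fintype _).summable, ?_⟩
    have : ∀ n : ℕ, ∑' y : Fin n → Klein, ((fun t : List Klein => (8⁻¹ : ℝ) ^ t.length) ∘
        (List.equivSigmaTuple (α := Klein)).symm) ⟨n, y⟩ = (2⁻¹ : ℝ) ^ n := fun n => by
      simp only [Function.comp, List.equivSigmaTuple, Equiv.coe_fn_symm_mk, List.length_ofFn,
        tsum_fintype, Finset.sum_const, Finset.card_univ]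
      rw [nsmul_eq_mul, Fintype.card_fun]
      push_cast [Fintype.card_prod, Fintype.card_bool, Fintype.card_fin]
      rw [← mul_pow]
      norm_num
    exact (summable_geometric_of_lt_one (by norm_num) (by norm_num)).congr fun n => (this n).symm
  have h2 : Summable fun _ : Klein => (8⁻¹ : ℝ) := (hasSum_fintype _).summable
  refine (h2.mul_of_nonneg h1 (fun _ => by positivity) (fun _ => by positivity)).congr ?_
  intro w
  rw [pow_succ']

theorem weightedLength_const (n : ℕ) (w : Klein × List Klein) :
    weightedLength (fun _ => n) w = n + (1 + n) * w.2.length := by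
  simp [weightedLength, mul_comm]

theorem hasCoding_one (ω : ℕ → Fin 3) (ξ : Ray) : HasCoding ω ξ (fun _ => 1) 1 := by
  refine ⟨Klein × List Klein, fun w => w.2.length + 1, fun w => hits ω (basePoints ω ξ) w.1 w.2, id,
    0, summable_inv_eight_pow_length, fun w => ?_, fun w w' h => by rw [show w = w' from h],
    fun w => subset_rfl, fun w => ?_⟩
  · exact (card_hits_le _ _ _ _).trans (Nat.mul_le_mul_right _ (card_basePoints_le _ _))
  · rw [weightedLength_const]
    push_cast [id]
    have : (0 : ℝ) ≤ w.2.length := by positivity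
    linarith

theorem mk_eq_mk_of_label {ω : ℕ → Fin 3} {g h : GrigF}
    (hp : ∀ x, grigPerm (ω 0) g x = grigPerm (ω 0) h x)
    (hl : ∀ x, (grigLabel (ω 0) g x : GrigGroup (seqShift ω)) = grigLabel (ω 0) h x) :
    (g : GrigGroup ω) = h := by
  have hsurj : Function.Surjective (grigPerm (ω 0) g) :=
    ((grigRec (ω 0) g).right.unop : Equiv.Perm Bool).surjective
  have hgh : h = g * (g⁻¹ * h) := by group
  have h1 : ∀ x, grigPerm (ω 0) (g⁻¹ * h) x = x := fun x => by
    obtain ⟨y, rfl⟩ := hsurj x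
    rw [← grigPerm_mul, ← hgh, hp]
  have h2 : ∀ x, grigLabel (ω 0) (g⁻¹ * h) x ∈ grigKer (seqShift ω) := fun x => by
    obtain ⟨y, rfl⟩ := hsurj x
    have := QuotientGroup.eq.1 (hl y)
    rwa [show grigLabel (ω 0) h y = grigLabel (ω 0) g y *
      grigLabel (ω 0) (g⁻¹ * h) (grigPerm (ω 0) g y) by rw [← grigLabel_mul, ← hgh],
      inv_mul_cancel_left] at this
  choose n hn using fun x => (mem_grigKer _ _).1 (h2 x)
  -- The `grigN` increase, so the larger index serves both labels; the recursion adds one.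
  refine QuotientGroup.eq.2 ((mem_grigKer _ _).2 ⟨max (n false) (n true) + 1, h1, ?_⟩)
  rintro (_ | _)
  · exact grigN_mono _ (le_max_left _ _) (hn false)
  · exact grigN_mono _ (le_max_right _ _) (hn true)

/-- The ray `x' x` with last letter `x`. -/
def rayCons (x : Bool) (x' : Ray) : Ray := fun n => Nat.casesOn n x x'

theorem rayCons_seqShift (x : Ray) : rayCons (x 0) (seqShift x) = x := by
  funext n
  cases n <;> rfl

/-- A code records the root permutation and the codes of the two labels. Weights add, so the new
series is a constant times the square of the old one. The constants get worse at each level, but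
only finitely many levels are used for a given `A`. -/
theorem HasCoding.of_seqShift {ω : ℕ → Fin 3} {ξ : Ray} {c c' : Klein → ℕ} {A : ℝ} (hA : 0 ≤ A)
    (hc : ∀ v, 1 ≤ c v) (hc' : ∀ v, 1 ≤ c' v ∧ c' v ≤ 2)
    (h0 : ∀ v, killed (ω 0) v = false → c' v = c v)
    (h : HasCoding (seqShift ω) (seqShift ξ) c' A) : HasCoding ω ξ c A := by
  classical
  obtain ⟨ι, wt, O, code, B, hs, hO, hval, hhit, hwt⟩ := h
  refine ⟨(Bool → Bool) × ι × ι, fun p => wt p.2.1 + wt p.2.2,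
    fun p => (O p.2.1).image (rayCons false) ∪ (O p.2.2).image (rayCons true),
    fun w => (grigPerm (ω 0) (wordValue w.1 w.2), code (labelWord (ω 0) w false),
      code (labelWord (ω 0) w true)), A * 6 + 2 * B, ?_, fun p => ?_, fun w w' hw => ?_,
      fun w x hx => ?_, fun w => ?_⟩
  · have h2 : Summable fun _ : Bool → Bool => (1 : ℝ) := (hasSum_fintype _).summable
    refine (h2.mul_of_nonneg (hs.mul_of_nonneg hs (fun _ => by positivity)
      fun _ => by positivity) (fun _ => by positivity) (fun _ => by positivity)).congr fun p => ?_
    simp [pow_add]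
  · refine (Finset.card_union_le _ _).trans ?_
    rw [mul_add]
    exact add_le_add (Finset.card_image_le.trans (hO _)) (Finset.card_image_le.trans (hO _))
  · simp only [Prod.mk.injEq] at hw
    refine mk_eq_mk_of_label (fun x => congrFun hw.1 x) ?_
    have h1 := hval _ _ hw.2.1
    have h2 := hval _ _ hw.2.2
    simp only [wordValue_labelWord] at h1 h2
    rintro (_ | _)
    exacts [h1, h2]
  · have h1 := hhit _ (seqShift_mem_hits (grigAct_toF_mem_basePoints (seqShift ω) (seqShift ξ))
      (seqShift_mem_basePoints ω ξ) hx)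
    rw [Finset.mem_union]
    rw [← rayCons_seqShift x]
    rcases hx0 : x 0 with _ | _
    · rw [hx0] at h1
      exact Or.inl (Finset.mem_image_of_mem _ h1)
    · rw [hx0] at h1
      exact Or.inr (Finset.mem_image_of_mem _ h1)
  · have h1 := hwt (labelWord (ω 0) w false)
    have h2 := hwt (labelWord (ω 0) w true)
    have h3 : ((weightedLength c' (labelWord (ω 0) w false) +
      weightedLength c' (labelWord (ω 0) w true) : ℕ) : ℝ) ≤ (weightedLength c w + 6 : ℕ) :=
      Nat.cast_le.2 (weightedLength_labelWord (ω 0) hc hc' h0 w)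
    have h4 := mul_le_mul_of_nonneg_left h3 hA
    push_cast at h4 ⊢
    linarith

/-- On the way down, the weight of `v` is raised to 2 as soon as a level kills it; the hypothesis
says that whatever still weighs 1 is killed at a later level before `k`. -/
theorem HasCoding.of_shifts {A : ℝ} (hA : 0 ≤ A) (k : ℕ) {ω : ℕ → Fin 3} {ξ : Ray}
    {c : Klein → ℕ} (hc : ∀ v, 1 ≤ c v ∧ c v ≤ 2)
    (hk : ∀ v, c v = 1 → ∃ j < k, killed (ω j) v = true)
    (h : HasCoding (seqShift^[k] ω) (seqShift^[k] ξ) (fun _ => 2) A) : HasCoding ω ξ c A := by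
  induction k generalizing ω ξ c with
  | zero =>
    have : c = fun _ => 2 := funext fun v => by
      have := hc v
      have := hk v
      by_contra h2
      obtain ⟨j, hj, -⟩ := this (by omega)
      omega
    rw [this]
    exact h
  | succ k ih =>
    refine HasCoding.of_seqShift (c' := fun v => if killed (ω 0) v then 2 else c v) hA
      (fun v => (hc v).1) (fun v => ?_) (fun v hv => by simp [hv]) (ih (fun v => ?_) (fun v hv => ?_) h)
    · split_ifs
      exacts [⟨by norm_num, le_rfl⟩, hc v]
    · split_ifs
      exacts [⟨by norm_num, le_rfl⟩, hc v]
    · by_cases h0 : killed (ω 0) v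
      · simp [h0] at hv
      simp only [h0, Bool.false_eq_true, if_false] at hv
      obtain ⟨j, hj, hjv⟩ := hk v hv
      cases j with
      | zero => exact absurd hjv h0
      | succ j => exact ⟨j, by omega, hjv⟩

theorem seqShift_iterate {α : Type*} (k : ℕ) (ω : ℕ → α) (n : ℕ) :
    seqShift^[k] ω n = ω (n + k) := by
  induction k generalizing ω with
  | zero => rfl
  | succ k ih => rw [Function.iterate_succ_apply, ih]; exact congrArg ω (by omega)

theorem seqShift_iterate_mem_OmegaPrime {ω : ℕ → Fin 3} (hω : ω ∈ OmegaPrime) (k : ℕ) :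
    seqShift^[k] ω ∈ OmegaPrime := by
  intro i
  refine Set.infinite_of_forall_exists_gt fun m => ?_
  obtain ⟨n, hn, hmn⟩ := (hω i).exists_gt (m + k)
  refine ⟨n - k, ?_, by omega⟩
  rw [Set.mem_ofPred_eq, seqShift_iterate, Nat.sub_add_cancel (by omega)]
  exact hn

theorem hasCoding_pow (m : ℕ) {ω : ℕ → Fin 3} (hω : ω ∈ OmegaPrime) (ξ : Ray) :
    HasCoding ω ξ (fun _ => 1) ((2 / 3 : ℝ) ^ m) := by
  induction m generalizing ω ξ with
  | zero => simpa using hasCoding_one ω ξ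
  | succ m ih =>
    -- Each symbol occurs among the first `sup j + 1` entries, so each `v` is killed at one of these
    -- levels.
    choose j hj using fun i => (hω i).nonempty
    refine HasCoding.of_shifts (by positivity) (Finset.univ.sup j + 1) (fun _ => by norm_num)
      (fun v _ => ?_) ?_
    · obtain ⟨i, hi⟩ := exists_killed v
      refine ⟨j i, Nat.lt_succ_of_le (Finset.le_sup (Finset.mem_univ i)), ?_⟩
      rwa [show ω (j i) = i from hj i]
    · obtain ⟨ι, wt, O, code, B, hs, hO, hval, hhit, hwt⟩ :=
        ih (seqShift_iterate_mem_OmegaPrime hω (Finset.univ.sup j + 1))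
          (seqShift^[Finset.univ.sup j + 1] ξ)
      refine ⟨ι, wt, O, code, B, hs, hO, hval, hhit, fun w => (hwt w).trans ?_⟩
      -- The gain at this stage: `1 + 2n ≤ (2/3) * (2 + 3n)`.
      rw [weightedLength_const, weightedLength_const, pow_succ, mul_assoc]
      gcongr
      push_cast
      linarith

/-! ### Growth functions -/

section GrowthBounds

variable {G : Type*} [Group G] {S : Set G}

theorem wordNorm_mul_le (hS : IsFiniteSymmGen S) (g h : G) :
    wordNorm S (g * h) ≤ wordNorm S g + wordNorm S h := by
  obtain ⟨l, l1, l2, rfl⟩ := hS.exists_word g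
  obtain ⟨m, m1, m2, rfl⟩ := hS.exists_word h
  rw [← l1, ← m1, ← List.length_append, ← List.prod_append]
  exact wordNorm_prod_le _ fun s hs => (List.mem_append.1 hs).elim (l2 s) (m2 s)

theorem wordNorm_one (S : Set G) : wordNorm S 1 = 0 := by
  simpa using wordNorm_prod_le (S := S) [] (by simp)

theorem wordNorm_le_one {s : G} (hs : s ∈ S) : wordNorm S s ≤ 1 := by
  simpa using wordNorm_prod_le (S := S) [s] (by simpa using hs)

theorem one_le_growthFunction (hS : IsFiniteSymmGen S) (R : ℕ) : 1 ≤ growthFunction S R :=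
  (Set.ncard_pos (hS.finite_ball R)).2 ⟨1, by simp [wordNorm_one]⟩

theorem growthFunction_mono (hS : IsFiniteSymmGen S) : Monotone (growthFunction S) :=
  fun _ _ h => Set.ncard_le_ncard (fun _ hg => le_trans hg h) (hS.finite_ball _)

theorem HasUnitGrowthRate.of_bound (hS : IsFiniteSymmGen S)
    (h : ∀ q : ℝ, 1 < q → ∃ K : ℝ, 0 < K ∧ ∀ R, (growthFunction S R : ℝ) ≤ K * q ^ R) :
    HasUnitGrowthRate S := by
  refine tendsto_order.2 ⟨fun a ha => Eventually.of_forall fun R => ha.trans_le ?_, fun a ha => ?_⟩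
  · exact Real.one_le_rpow (by exact_mod_cast one_le_growthFunction hS R) (by positivity)
  · obtain ⟨q, hq1, hqa⟩ := exists_between ha
    obtain ⟨K, hK, hv⟩ := h q hq1
    have hlim : Tendsto (fun R : ℕ => K ^ ((1 : ℝ) / R) * q) atTop (𝓝 (K ^ (0 : ℝ) * q)) :=
      (tendsto_const_nhds.rpow tendsto_one_div_atTop_nhds_zero_nat (Or.inl hK.ne')).mul_const q
    rw [Real.rpow_zero, one_mul] at hlim
    filter_upwards [hlim.eventually_lt_const hqa, eventually_gt_atTop 0] with R h1 h2
    refine lt_of_le_of_lt ?_ h1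
    have hq0 : 0 < q := by linarith
    have hR : (R : ℝ) ≠ 0 := by positivity
    calc (growthFunction S R : ℝ) ^ ((1 : ℝ) / R) ≤ (K * q ^ R) ^ ((1 : ℝ) / R) :=
          Real.rpow_le_rpow (by positivity) (hv R) (by positivity)
      _ = K ^ ((1 : ℝ) / R) * q := by
          rw [Real.mul_rpow hK.le (by positivity), ← Real.rpow_natCast q, ← Real.rpow_mul hq0.le,
            mul_one_div_cancel hR, Real.rpow_one]

theorem HasUnitGrowthRate.exists_bound (hS : IsFiniteSymmGen S) (h : HasUnitGrowthRate S)
    {q : ℝ} (hq : 1 < q) : ∃ K : ℝ, 0 < K ∧ ∀ R, (growthFunction S R : ℝ) ≤ K * q ^ R := by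
  obtain ⟨N, hN⟩ := eventually_atTop.1 (h.eventually_lt_const hq)
  have hN' : (1 : ℝ) ≤ growthFunction S (N + 1) := by
    exact_mod_cast one_le_growthFunction hS (N + 1)
  refine ⟨growthFunction S (N + 1), by linarith, fun R => ?_⟩
  have hqR : 1 ≤ q ^ R := one_le_pow₀ hq.le
  rcases le_total R (N + 1) with hR | hR
  · calc (growthFunction S R : ℝ) ≤ growthFunction S (N + 1) := by
          exact_mod_cast growthFunction_mono hS hR
      _ ≤ _ := le_mul_of_one_le_right (by positivity) hqR
  · have h1 := hN R (by omega)
    have hR0 : (R : ℝ) ≠ 0 := by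
      have : 0 < R := by omega
      positivity
    refine le_trans ?_ (le_mul_of_one_le_left (by positivity) hN')
    rw [← Real.rpow_natCast q]
    calc (growthFunction S R : ℝ) = ((growthFunction S R : ℝ) ^ ((1 : ℝ) / R)) ^ (R : ℝ) := by
          rw [← Real.rpow_mul (by positivity), one_div_mul_cancel hR0, Real.rpow_one]
      _ ≤ q ^ (R : ℝ) := Real.rpow_le_rpow (by positivity) h1.le (by positivity)

theorem HasUnitGrowthRate.exists_sum_bound (hS : IsFiniteSymmGen S) (h : HasUnitGrowthRate S)
    {t : ℝ} (ht0 : 0 < t) (ht1 : t < 1) :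
    ∃ Z : ℝ, 1 ≤ Z ∧ ∀ B : Finset G, ∑ g ∈ B, t ^ wordNorm S g ≤ Z := by
  -- With `1 < q < 1/t`, at most `K * q ^ j` elements have norm `j`, and the geometric series of
  -- ratio `q * t` converges.
  obtain ⟨q, hq1, hqt⟩ := exists_between (one_lt_inv_iff₀.2 ⟨ht0, ht1⟩)
  have hq0 : 0 < q := by linarith
  have hqt1 : q * t < 1 := by rwa [lt_inv_comm₀ hq0 ht0, ← one_div, lt_div_iff₀ hq0, mul_comm] at hqt
  obtain ⟨K, hK, hv⟩ := h.exists_bound hS hq1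
  refine ⟨max 1 (K * (1 - q * t)⁻¹), le_max_left _ _, fun B => le_trans ?_ (le_max_right _ _)⟩
  have hmap : ∀ g ∈ B, wordNorm S g ∈ Finset.range (B.sup (wordNorm S) + 1) := fun g hg =>
    Finset.mem_range.2 (Nat.lt_succ_of_le (Finset.le_sup hg))
  rw [← Finset.sum_fiberwise_of_maps_to hmap]
  calc _ ≤ ∑ j ∈ Finset.range (B.sup (wordNorm S) + 1), K * (q * t) ^ j := by
        refine Finset.sum_le_sum fun j _ => ?_
        rw [Finset.sum_congr rfl (g := fun _ => t ^ j)
          (fun g hg => by rw [(Finset.mem_filter.1 hg).2]), Finset.sum_const, nsmul_eq_mul,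
          mul_pow, ← mul_assoc]
        refine mul_le_mul_of_nonneg_right (le_trans ?_ (hv j)) (by positivity)
        rw [← Set.ncard_coe_finset]
        exact Nat.cast_le.2 (Set.ncard_le_ncard
          (fun g hg => (Finset.mem_filter.1 hg).2.le) (hS.finite_ball j))
    _ = K * ∑ j ∈ Finset.range (B.sup (wordNorm S) + 1), (q * t) ^ j := by rw [Finset.mul_sum]
    _ ≤ K * (1 - q * t)⁻¹ := by
        refine mul_le_mul_of_nonneg_left ?_ hK.le
        rw [← tsum_geometric_of_lt_one (by positivity) hqt1]
        exact (summable_geometric_of_lt_one (by positivity) hqt1).sum_le_tsum _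
          fun _ _ => by positivity

/-- The number of functions on a finite set with total norm at most `n`. -/
theorem card_le_of_sum_wordNorm_le {t Z : ℝ} (ht0 : 0 < t) (ht1 : t ≤ 1)
    (hZ : ∀ B : Finset G, ∑ g ∈ B, t ^ wordNorm S g ≤ Z) {α : Type*} [Fintype α]
    (n : ℕ) (Φ : Finset (α → G)) (hΦ : ∀ φ ∈ Φ, ∑ x, wordNorm S (φ x) ≤ n) :
    (Φ.card : ℝ) * t ^ n ≤ Z ^ Fintype.card α := by
  classical
  let B : α → Finset G := fun x => Φ.image fun φ => φ x
  -- A Chernoff-type bound: each `φ` has weight at least `t ^ n`, and the weights of all functions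
  -- add up to a product over the points.
  calc (Φ.card : ℝ) * t ^ n = ∑ φ ∈ Φ, t ^ n := by rw [Finset.sum_const, nsmul_eq_mul]
    _ ≤ ∑ φ ∈ Φ, ∏ x, t ^ wordNorm S (φ x) := Finset.sum_le_sum fun φ hφ => by
        rw [Finset.prod_pow_eq_pow_sum]
        exact pow_le_pow_of_le_one ht0.le ht1 (hΦ φ hφ)
    _ ≤ ∑ φ ∈ Fintype.piFinset B, ∏ x, t ^ wordNorm S (φ x) :=
        Finset.sum_le_sum_of_subset_of_nonneg
          (fun φ hφ => Fintype.mem_piFinset.2 fun x => Finset.mem_image_of_mem _ hφ)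
          fun _ _ _ => Finset.prod_nonneg fun _ _ => by positivity
    _ = ∏ x, ∑ g ∈ B x, t ^ wordNorm S g := by rw [Finset.prod_univ_sum]
    _ ≤ ∏ _x : α, Z := Finset.prod_le_prod
        (fun _ _ => Finset.sum_nonneg fun _ _ => by positivity) fun x _ => hZ _
    _ = _ := by simp

end GrowthBounds

/-! ### Generators of the wreath product -/

section WreathGenerators

variable {H X : Type*} [Group H]

open Classical in
/-- The function supported at `x` as an element of the restricted power. -/
noncomputable def singleHom (x : X) : H →* restrictedPower X H :=
  (MonoidHom.mulSingle (fun _ : X => H) x).codRestrict (restrictedPower X H) fun h =>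
    (Set.finite_singleton x).subset fun y hy => by
      by_contra hyx
      exact hy (Pi.mulSingle_eq_of_ne (M := fun _ : X => H) hyx h)

theorem singleHom_apply_self (x : X) (h : H) : (singleHom x h).1 x = h := by
  classical exact Pi.mulSingle_eq_same (M := fun _ : X => H) x h

theorem singleHom_apply_of_ne {x y : X} (hy : y ≠ x) (h : H) : (singleHom x h).1 y = 1 := by
  classical exact Pi.mulSingle_eq_of_ne (M := fun _ : X => H) hy h

theorem mem_of_singleHom_mem {K : Subgroup (restrictedPower X H)}
    (hK : ∀ x h, singleHom x h ∈ K) (f : restrictedPower X H) : f ∈ K := by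
  classical
  suffices ∀ (s : Finset X) (f : restrictedPower X H), (∀ x, f.1 x ≠ 1 → x ∈ s) → f ∈ K from
    this f.2.toFinset f fun x hx => f.2.mem_toFinset.2 hx
  intro s
  induction s using Finset.induction_on with
  | empty =>
    intro f hf
    have : f = 1 := by
      ext x
      by_contra hx
      exact absurd (hf x hx) (Finset.notMem_empty x)
    rw [this]
    exact one_mem K
  | insert x s hx ih =>
    intro f hf
    rw [← mul_inv_cancel_left (singleHom x (f.1 x)) f, ← map_inv]
    refine mul_mem (hK _ _) (ih _ fun y hy => ?_)
    rcases eq_or_ne y x with rfl | hyx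
    · refine absurd ?_ hy
      change (singleHom y (f.1 y)⁻¹).1 y * f.1 y = 1
      rw [singleHom_apply_self, inv_mul_cancel]
    · have h1 : (singleHom x (f.1 x)⁻¹).1 y * f.1 y ≠ 1 := hy
      rw [singleHom_apply_of_ne hyx, one_mul] at h1
      exact (Finset.mem_insert.1 (hf y h1)).resolve_left hyx

end WreathGenerators

section GrigWreathGenerators

variable {H : Type*} [Group H] (ω : ℕ → Fin 3) (ξ : Ray)

/-- The ray `ξ` as a point of its orbit. -/
def orbitBase : rayOrbit ω ξ := ⟨ξ, MulAction.mem_orbit_self ξ⟩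

/-- The generators of `W_ω(H)`: the letters `a, b, c, d`, and `S` placed at `ξ`. -/
def wreathGens (S : Set H) : Set (GrigWreath H ω ξ) :=
  Set.range (fun s => SemidirectProduct.inr (grigGen s : GrigGroup ω)) ∪
    (fun h => SemidirectProduct.inl (singleHom (orbitBase ω ξ) h)) '' S

theorem wreathGens_isFiniteSymmGen {S : Set H} (hS : IsFiniteSymmGen S) :
    IsFiniteSymmGen (wreathGens ω ξ S) := by
  refine ⟨?_, ?_, ?_⟩
  · have : Finite GrigLetter := by
      refine Finite.of_surjective (fun i : Fin 4 => ![GrigLetter.a, .b, .c, .d] i) ?_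
      rintro (_ | _ | _ | _)
      exacts [⟨0, rfl⟩, ⟨1, rfl⟩, ⟨2, rfl⟩, ⟨3, rfl⟩]
    exact (Set.finite_range _).union (hS.finite.image _)
  · rintro _ (⟨s, rfl⟩ | ⟨h, hh, rfl⟩)
    · refine Or.inl ⟨s, ?_⟩
      dsimp only
      rw [← map_inv, ← QuotientGroup.mk_inv, grigGen_inv]
    · refine Or.inr ⟨h⁻¹, hS.symm h hh, ?_⟩
      dsimp only
      rw [map_inv, map_inv]
  · set K := Subgroup.closure (wreathGens ω ξ S) with hKdef
    have hinr : ∀ g : GrigGroup ω, SemidirectProduct.inr g ∈ K := by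
      intro g
      obtain ⟨g, rfl⟩ := QuotientGroup.mk_surjective g
      have : (⊤ : Subgroup GrigF) ≤
          K.comap (SemidirectProduct.inr.comp (QuotientGroup.mk' (grigKer ω))) := by
        rw [← PresentedGroup.closure_range_of, Subgroup.closure_le]
        rintro _ ⟨s, rfl⟩
        exact Subgroup.subset_closure (Or.inl ⟨s, rfl⟩)
      exact this (Subgroup.mem_top g)
    have hbase : ∀ h : H, SemidirectProduct.inl (singleHom (orbitBase ω ξ) h) ∈ K := by
      intro h
      have : (⊤ : Subgroup H) ≤
          K.comap (SemidirectProduct.inl.comp (singleHom (orbitBase ω ξ))) := by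
        rw [← hS.generates, Subgroup.closure_le]
        exact fun s hs => Subgroup.subset_closure (Or.inr ⟨s, hs, rfl⟩)
      exact this (Subgroup.mem_top h)
    -- Conjugation by `G_ω` moves the copy of `H` at `ξ` to any point of the orbit.
    have hsingle : ∀ (x : rayOrbit ω ξ) (h : H), SemidirectProduct.inl (singleHom x h) ∈ K := by
      rintro ⟨_, g, rfl⟩ h
      have hx : ∀ y : rayOrbit ω ξ, MulOpposite.op g.unop⁻¹ • y = orbitBase ω ξ ↔
          y = g • orbitBase ω ξ := fun y => by
        rw [MulOpposite.op_inv, MulOpposite.op_unop, inv_smul_eq_iff]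
      have : singleHom (g • orbitBase ω ξ) h =
          translateHom H (rayOrbit ω ξ) (GrigGroup ω) g.unop⁻¹ (singleHom (orbitBase ω ξ) h) := by
        ext y
        change _ = (singleHom (orbitBase ω ξ) h).1 (MulOpposite.op g.unop⁻¹ • y)
        by_cases hy : y = g • orbitBase ω ξ
        · rw [(hx y).2 hy, hy, singleHom_apply_self, singleHom_apply_self]
        · rw [singleHom_apply_of_ne hy, singleHom_apply_of_ne fun h => hy ((hx y).1 h)]
      change SemidirectProduct.inl (singleHom (g • orbitBase ω ξ) h) ∈ K
      rw [this, SemidirectProduct.inl_aut]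
      exact mul_mem (mul_mem (hinr _) (hbase h)) (hinr _)
    refine (Subgroup.eq_top_iff' K).2 fun u => ?_
    rw [← SemidirectProduct.inl_left_mul_inr_right u]
    refine mul_mem ?_ (hinr _)
    exact mem_of_singleHom_mem (K := K.comap SemidirectProduct.inl) hsingle u.left

theorem exists_toF_eq (s : GrigLetter) : s = .a ∨ ∃ v, grigGen s = toF v := by
  cases s
  · exact Or.inl rfl
  · exact Or.inr ⟨(true, false), by simp [toF]⟩
  · exact Or.inr ⟨(false, true), by simp [toF]⟩
  · exact Or.inr ⟨(true, true), by simp [toF, grigGen_bc]⟩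

/-- The base part of a product of `n` generators is supported in the hitting set of a word of
length at most `n`, and has total norm at most `n`. -/
theorem exists_word_of_wreath_list {S : Set H} (hS : IsFiniteSymmGen S)
    (l : List (GrigWreath H ω ξ)) (hl : ∀ u ∈ l, u ∈ wreathGens ω ξ S) :
    (∃ w : Klein × List Klein, w.2.length ≤ l.length ∧ l.prod.right = (wordValue w.1 w.2 : GrigF) ∧
      ∀ x, l.prod.left.1 x ≠ 1 → x.1 ∈ hits ω (basePoints ω ξ) w.1 w.2) ∧
    ∀ T : Finset (rayOrbit ω ξ), ∑ x ∈ T, wordNorm S (l.prod.left.1 x) ≤ l.length := by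
  classical
  induction l with
  | nil =>
    refine ⟨⟨(one, []), by simp, by simp [wordValue], fun x hx => absurd rfl hx⟩, fun T => ?_⟩
    refine (Finset.sum_eq_zero fun x _ => ?_).le
    exact wordNorm_one S
  | cons u l ih =>
    obtain ⟨⟨w, hw1, hw2, hw3⟩, hT⟩ := ih fun v hv => hl v (List.mem_cons_of_mem _ hv)
    rcases hl u List.mem_cons_self with ⟨s, rfl⟩ | ⟨h, hh, rfl⟩
    · have hleft : ∀ x, (SemidirectProduct.inr (grigGen s : GrigGroup ω) * l.prod).left.1 x =
          l.prod.left.1 (MulOpposite.op (grigGen s : GrigGroup ω) • x) := fun x => by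
        rw [SemidirectProduct.mul_left, SemidirectProduct.left_inr, one_mul]
        rfl
      have hright : (SemidirectProduct.inr (grigGen s : GrigGroup ω) * l.prod).right =
          ((grigGen s * wordValue w.1 w.2 : GrigF) : GrigGroup ω) := by
        rw [SemidirectProduct.mul_right, SemidirectProduct.right_inr, hw2]
        rfl
      simp only [List.prod_cons, hleft, hright, List.length_cons]
      refine ⟨?_, fun T => ?_⟩
      · rcases exists_toF_eq s with rfl | ⟨v, hv⟩
        · refine ⟨(one, w.1 :: w.2), by simpa using hw1, by simp [wordValue], fun x hx => ?_⟩
          refine mem_hits_cons.2 (Or.inr ?_)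
          rw [toF_one, one_mul]
          exact hw3 _ hx
        · refine ⟨(mul v w.1, w.2), by dsimp only; omega, by rw [wordValue_mul, hv],
            fun x hx => mem_hits_mul (grigAct_toF_mem_basePoints ω ξ) ?_⟩
          rw [← hv]
          exact hw3 _ hx
      -- A letter of `G_ω` only permutes the points, so the sum over `T` becomes one over a
      -- translate of `T`.
      · refine le_trans ?_ (Nat.le_succ_of_le
          (hT (T.image (MulOpposite.op (grigGen s : GrigGroup ω) • ·))))
        rw [Finset.sum_image (MulAction.injective _).injOn]
    · have hleft : ∀ x, (SemidirectProduct.inl (singleHom (orbitBase ω ξ) h) * l.prod).left.1 x =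
          (singleHom (orbitBase ω ξ) h).1 x * l.prod.left.1 x := fun x => by
        rw [SemidirectProduct.mul_left, SemidirectProduct.left_inl, SemidirectProduct.right_inl,
          map_one]
        rfl
      have hright : (SemidirectProduct.inl (singleHom (orbitBase ω ξ) h) * l.prod).right =
          l.prod.right := by
        rw [SemidirectProduct.mul_right, SemidirectProduct.right_inl, one_mul]
      simp only [List.prod_cons, hleft, hright, List.length_cons]
      refine ⟨⟨w, by omega, hw2, fun x hx => ?_⟩, fun T => ?_⟩
      -- A letter from `H` changes the function only at `ξ`, which every hitting set contains.
      · rcases eq_or_ne x (orbitBase ω ξ) with rfl | hne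
        · exact subset_hits _ _ _ _ (self_mem_basePoints ω ξ)
        · rw [singleHom_apply_of_ne hne, one_mul] at hx
          exact hw3 x hx
      · have h1 : ∑ x ∈ T, wordNorm S ((singleHom (orbitBase ω ξ) h).1 x) ≤ 1 := by
          refine (Finset.sum_le_sum (g := fun x => if x = orbitBase ω ξ then 1 else 0)
            fun x _ => ?_).trans ?_
          · split_ifs with hx
            · rw [hx, singleHom_apply_self]
              exact wordNorm_le_one hh
            · rw [singleHom_apply_of_ne hx, wordNorm_one]
          · rw [Finset.sum_ite_eq']
            split_ifs <;> simp
        have h2 := hT T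
        have h3 : ∑ x ∈ T, wordNorm S ((singleHom (orbitBase ω ξ) h).1 x * l.prod.left.1 x) ≤
            _ := Finset.sum_le_sum fun x _ => wordNorm_mul_le hS _ _
        rw [Finset.sum_add_distrib] at h3
        omega

end GrigWreathGenerators

/-! ### Growth of the wreath product -/

theorem exists_pow_rpow_le {M s : ℝ} (hM : 0 < M) (hs : 1 < s) :
    ∃ m : ℕ, M ^ (2 * (2 / 3 : ℝ) ^ m) ≤ s := by
  have h1 : Tendsto (fun m : ℕ => 2 * (2 / 3 : ℝ) ^ m) atTop (𝓝 (2 * 0)) :=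
    (tendsto_pow_atTop_nhds_zero_of_lt_one (by norm_num) (by norm_num)).const_mul 2
  have h2 : Tendsto (fun m : ℕ => M ^ (2 * (2 / 3 : ℝ) ^ m)) atTop (𝓝 (M ^ (2 * 0 : ℝ))) :=
    tendsto_const_nhds.rpow h1 (Or.inl hM.ne')
  rw [mul_zero, Real.rpow_zero] at h2
  obtain ⟨m, hm⟩ := (h2.eventually_lt_const hs).exists
  exact ⟨m, hm.le⟩

section

variable {H : Type*} [Group H] {ω : ℕ → Fin 3} {ξ : Ray}

/-- A bound for the number of elements with a given image in `G_ω`, base part supported in `O`, and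
total norm at most `R`. -/
theorem card_wreath_fiber_le {S : Set H} {t Z : ℝ} (ht0 : 0 < t) (ht1 : t ≤ 1) (hZ1 : 1 ≤ Z)
    (hZ : ∀ B : Finset H, ∑ h ∈ B, t ^ wordNorm S h ≤ Z) (O : Finset Ray) (R : ℕ)
    (U : Finset (GrigWreath H ω ξ)) (hright : ∀ u ∈ U, ∀ u' ∈ U, u.right = u'.right)
    (hsupp : ∀ u ∈ U, ∀ x, u.left.1 x ≠ 1 → x.1 ∈ O)
    (hsum : ∀ u ∈ U, ∀ T : Finset (rayOrbit ω ξ), ∑ x ∈ T, wordNorm S (u.left.1 x) ≤ R) :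
    (U.card : ℝ) * t ^ R ≤ Z ^ O.card := by
  classical
  let T : Finset (rayOrbit ω ξ) := O.subtype (· ∈ rayOrbit ω ξ)
  let φ : GrigWreath H ω ξ → T → H := fun u y => u.left.1 y.1
  have hinj : Set.InjOn φ U := fun u hu u' hu' h => by
    refine SemidirectProduct.ext (Subtype.ext (funext fun x => ?_)) (hright u hu u' hu')
    by_cases hx : x.1 ∈ O
    · exact congrFun h ⟨x, Finset.mem_subtype.2 hx⟩
    · rw [not_not.1 fun h => hx (hsupp u hu x h), not_not.1 fun h => hx (hsupp u' hu' x h)]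
  have h1 := card_le_of_sum_wordNorm_le ht0 ht1 hZ R (U.image φ) fun ψ hψ => by
    obtain ⟨u, hu, rfl⟩ := Finset.mem_image.1 hψ
    exact (Finset.sum_coe_sort T fun x => wordNorm S (u.left.1 x)).trans_le (hsum u hu T)
  rw [Finset.card_image_of_injOn hinj, Fintype.card_coe] at h1
  refine h1.trans (pow_le_pow_right₀ hZ1 ?_)
  rw [Finset.card_subtype]
  exact Finset.card_filter_le _ _

/-- The ball is sorted by the codes of its words. A code of weight `n` contributes at most `Z ^
(8n)`, and summability of `8⁻¹ ^ n` over all codes absorbs their number. -/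
theorem growthFunction_wreath_le {S : Set H} (hS : IsFiniteSymmGen S) {A : ℝ} (hA : 0 ≤ A)
    (hcode : HasCoding ω ξ (fun _ => 1) A) {t Z : ℝ} (ht0 : 0 < t) (ht1 : t ≤ 1) (hZ1 : 1 ≤ Z)
    (hZ : ∀ B : Finset H, ∑ h ∈ B, t ^ wordNorm S h ≤ Z) :
    ∃ K B : ℝ, 0 < K ∧ ∀ R : ℕ, (growthFunction (wreathGens ω ξ S) R : ℝ) * t ^ R ≤
      K * (8 * Z ^ 8) ^ (A * (1 + 2 * R) + B) := by
  classical
  obtain ⟨ι, wt, O, code, B, hs, hO, hval, hhit, hwt⟩ := hcode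
  have hgen := wreathGens_isFiniteSymmGen ω ξ hS
  have hM : 1 ≤ 8 * Z ^ 8 := by
    have := one_le_pow₀ (n := 8) hZ1
    linarith
  have hword : ∀ u : GrigWreath H ω ξ, ∃ w : Klein × List Klein,
      w.2.length ≤ wordNorm (wreathGens ω ξ S) u ∧ u.right = (wordValue w.1 w.2 : GrigF) ∧
      (∀ x, u.left.1 x ≠ 1 → x.1 ∈ hits ω (basePoints ω ξ) w.1 w.2) ∧
      ∀ T : Finset (rayOrbit ω ξ),
        ∑ x ∈ T, wordNorm S (u.left.1 x) ≤ wordNorm (wreathGens ω ξ S) u := fun u => by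
    obtain ⟨l, l1, l2, l3⟩ := hgen.exists_word u
    obtain ⟨⟨w, h1, h2, h3⟩, h4⟩ := exists_word_of_wreath_list ω ξ hS l l2
    rw [l3, ← l1] at *
    exact ⟨w, h1, h2, h3, h4⟩
  choose w hw1 hw2 hw3 hw4 using hword
  -- The summand 1 only ensures positivity.
  refine ⟨∑' i, (8⁻¹ : ℝ) ^ wt i + 1, B, add_pos_of_nonneg_of_pos
    (tsum_nonneg fun _ => by positivity) one_pos, fun R => ?_⟩
  let U : Finset (GrigWreath H ω ξ) := (hgen.finite_ball R).toFinset
  have hU : ∀ u ∈ U, wordNorm (wreathGens ω ξ S) u ≤ R := fun u hu =>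
    (hgen.finite_ball R).mem_toFinset.1 hu
  let I : Finset ι := U.image fun u => code (w u)
  have hcard : growthFunction (wreathGens ω ξ S) R = U.card :=
    Set.ncard_eq_toFinset_card _ (hgen.finite_ball R)
  have hwtI : ∀ i ∈ I, (wt i : ℝ) ≤ A * (1 + 2 * R) + B := fun i hi => by
    obtain ⟨u, hu, rfl⟩ := Finset.mem_image.1 hi
    refine (hwt (w u)).trans ?_
    have h1 : ((w u).2.length : ℝ) ≤ R := by exact_mod_cast (hw1 u).trans (hU u hu)
    rw [weightedLength_const]
    gcongr
    push_cast
    linarith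
  rw [hcard, Finset.card_eq_sum_card_image (fun u => code (w u)) U, Nat.cast_sum, Finset.sum_mul]
  calc _ ≤ ∑ i ∈ I, (8⁻¹ : ℝ) ^ wt i * (8 * Z ^ 8) ^ (A * (1 + 2 * R) + B) := by
        refine Finset.sum_le_sum fun i hi => ?_
        have hmem : ∀ u ∈ U.filter fun u => code (w u) = i, u ∈ U ∧ code (w u) = i :=
          fun u hu => Finset.mem_filter.1 hu
        refine (card_wreath_fiber_le ht0 ht1 hZ1 hZ (O i) R _ (fun u hu u' hu' => ?_)
          (fun u hu x hx => ?_) fun u hu T => ?_).trans ?_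
        · rw [hw2, hw2]
          exact hval _ _ ((hmem u hu).2.trans (hmem u' hu').2.symm)
        · rw [← (hmem u hu).2]
          exact hhit _ (hw3 u x hx)
        · exact (hw4 u T).trans (hU u (hmem u hu).1)
        · calc Z ^ (O i).card ≤ Z ^ (8 * wt i) := pow_le_pow_right₀ hZ1 (hO i)
            _ = (8⁻¹ : ℝ) ^ wt i * (8 * Z ^ 8) ^ (wt i : ℝ) := by
              rw [Real.rpow_natCast, ← mul_pow, inv_mul_cancel_left₀ (by norm_num), pow_mul]
            _ ≤ _ := by
              gcongr
              exact hwtI i hi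
    _ = (∑ i ∈ I, (8⁻¹ : ℝ) ^ wt i) * (8 * Z ^ 8) ^ (A * (1 + 2 * R) + B) := by
        rw [Finset.sum_mul]
    _ ≤ _ := by
        gcongr
        exact (hs.sum_le_tsum I fun _ _ => by positivity).trans (by linarith)

end

theorem mainTheorem5 {H : Type*} [Group H] (hH : HasSubexponentialGrowth H)
    (ω : ℕ → Fin 3) (hω : ω ∈ OmegaPrime) (ξ : Ray) :
    HasSubexponentialGrowth (GrigWreath H ω ξ) := by
  obtain ⟨S, hS, hlim⟩ := hH
  have hgen := wreathGens_isFiniteSymmGen ω ξ hS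
  refine ⟨_, hgen, HasUnitGrowthRate.of_bound hgen fun q hq => ?_⟩
  -- One factor `√q ^ R` pays for `t ^ (-R)` with `t = 1/√q`; the other pays for the codes and the
  -- supports, once `m` is large in terms of `Z`.
  have hs : 1 < √q := Real.lt_sqrt_of_sq_lt (by simpa using hq)
  have hs0 : 0 < √q := by linarith
  have ht0 : 0 < (√q)⁻¹ := inv_pos.2 hs0
  obtain ⟨Z, hZ1, hZ⟩ := hlim.exists_sum_bound hS ht0 (inv_lt_one_of_one_lt₀ hs)
  have hM : 0 < 8 * Z ^ 8 := by positivity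
  obtain ⟨m, hm⟩ := exists_pow_rpow_le hM hs
  obtain ⟨K, B, hK, hbound⟩ := growthFunction_wreath_le hS (by positivity)
    (hasCoding_pow m hω ξ) ht0 (inv_le_one_of_one_le₀ hs.le) hZ1 hZ
  refine ⟨K * (8 * Z ^ 8) ^ ((2 / 3 : ℝ) ^ m + B), by positivity, fun R => ?_⟩
  have h1 := hbound R
  rw [inv_pow, ← div_eq_mul_inv, div_le_iff₀ (by positivity)] at h1
  refine h1.trans ?_
  have h2 : (8 * Z ^ 8) ^ ((2 / 3 : ℝ) ^ m * (1 + 2 * R) + B) =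
      (8 * Z ^ 8) ^ ((2 / 3 : ℝ) ^ m + B) * ((8 * Z ^ 8) ^ (2 * (2 / 3 : ℝ) ^ m)) ^ R := by
    rw [← Real.rpow_mul_natCast hM.le, ← Real.rpow_add hM]
    congr 1
    ring
  have h3 : q ^ R = √q ^ R * √q ^ R := by rw [← mul_pow, Real.mul_self_sqrt (by linarith)]
  rw [h2, h3, ← mul_assoc, ← mul_assoc]
  gcongr
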